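/- Let $\mathrm{L}$ be a relational $\omega$-signature, i.e. a set of relation symbols of finite arity and of constant symbols (no other function symbols), and let $\kappa$ be an infinite cardinal. Fix a set of variables $\{v_\alpha:\alpha<\kappa\}$. Terms are variables and constant symbols; atomic formulas are $t=u$ and $R(t_1,\dots,t_n)$. The $\mathrm{L}_{\kappa\omega}$-formulas are the smallest class that contains the atomic formulas and is closed under $\neg$, under $\bigwedge\Phi$ and $\bigvee\Phi$ for sets $\Phi$ of fewer than $\kappa$ formulas whose free variables all lie in one finite set, and under $\forall V\phi$ and $\exists V\phi$ for finite sets $V$ of variables; $\phi\to\psi$ abbreviates $\bigvee\{\neg\phi,\psi\}$, and a sentence is a formula without free variables. For a complete Boolean algebra $\mathsf{B}$, a $\mathsf{B}$-valued model $\mathcal{M}$ for $\mathrm{L}$ consists of a non-empty set $M$, a map $(\tau,\sigma)\mapsto[\![\tau=\sigma]\!]\in\mathsf{B}$ on $M^2$, maps $R^{\mathcal{M}}=[\![R(\cdot)]\!]:M^n\to\mathsf{B}$ for each $n$-ary relation symbol $R$ of $\mathrm{L}$, and elements $c^{\mathcal{M}}\in M$ for each constant symbol $c$ of $\mathrm{L}$,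 such that $[\![\tau=\tau]\!]=1$, $[\![\tau=\sigma]\!]=[\![\sigma=\tau]\!]$, $[\![\tau=\sigma]\!]\wedge[\![\sigma=\pi]\!]\le[\![\tau=\pi]\!]$ and $\bigwedge_{i}[\![\tau_i=\sigma_i]\!]\wedge[\![R(\tau_1,\dots,\tau_n)]\!]\le[\![R(\sigma_1,\dots,\sigma_n)]\!]$. The value $[\![\phi]\!]\in\mathsf{B}$ of a formula under an assignment of the variables in $M$ is defined by recursion, interpreting $\neg$, $\bigwedge$, $\bigvee$ by the operations of $\mathsf{B}$ and $\forall V$, $\exists V$ by the infimum and the supremum over all $\bar a\in M^V$. The model $\mathcal{M}$ has the mixing property if for every set $A\subseteq\mathsf{B}$ of pairwise disjoint elements and every family $(\tau_a)_{a\in A}$ in $M$ there is $\tau\in M$ with $a\le[\![\tau=\tau_a]\!]$ for all $a\in A$. Write $\vDash_{\mathrm{Sh}}\chi$ if $[\![\chi]\!]=1_{\mathsf{B}}$ under every assignment in every $\mathsf{B}$-valued model for $\mathrm{L}$ with the mixing property, for every complete Boolean algebra $\mathsf{B}$. **Theorem (Boolean Craig Interpolation).** Let $\phi,\psi$ be $\mathrm{L}_{\kappa\omega}$-sentences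 such that $\vDash_{\mathrm{Sh}}\phi\to\psi$. Then there is an $\mathrm{L}_{\kappa\omega}$-sentence $\theta$ such that 1. $\vDash_{\mathrm{Sh}}\phi\to\theta$, 2. $\vDash_{\mathrm{Sh}}\theta\to\psi$, 3. every non-logical symbol (relation symbol or constant symbol) that occurs in $\theta$ occurs both in $\phi$ and in $\psi$. -/

import Mathlib

open Cardinal

universe u

/-- A relational `ω`-signature: relation symbols of finite arity and constant symbols
(no function symbols of positive arity). -/
structure RelSignature : Type (u + 1) where
  /-- the relation symbols -/
  Rel : Type u
  /-- the arity of each relation symbol -/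
  arity : Rel → ℕ
  /-- the constant symbols -/
  Const : Type u

namespace RelSignature

/-- The variables `v_α` for `α < κ`. -/
abbrev Var (κ : Cardinal.{u}) : Type u := κ.ord.ToType

/-- Terms: variables and constant symbols. -/
inductive Term (L : RelSignature.{u}) (κ : Cardinal.{u}) : Type u
  | var (x : Var κ) : Term L κ
  | const (c : L.Const) : Term L κ

/-- The pre-formulas of `L_{κω}`, that is, formulas without the restriction on the number of free
variables of a conjunction or disjunction. A set of fewer than `κ` pre-formulas is presented as a
family indexed by a subset, of size less than `κ`, of a fixed set of size `κ` (the order type of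
the ordinals below `κ`). Quantifiers bind a finite set of variables simultaneously. -/
inductive PreFormula (L : RelSignature.{u}) (κ : Cardinal.{u}) : Type u
  | eq (t₁ t₂ : Term L κ) : PreFormula L κ
  | rel (R : L.Rel) (ts : Fin (L.arity R) → Term L κ) : PreFormula L κ
  | neg (φ : PreFormula L κ) : PreFormula L κ
  | conj (I : Set κ.ord.ToType) (hI : #I < κ) (Φ : I → PreFormula L κ) : PreFormula L κ
  | disj (I : Set κ.ord.ToType) (hI : #I < κ) (Φ : I → PreFormula L κ) : PreFormula L κ
  | all (V : Finset (Var κ)) (φ : PreFormula L κ) : PreFormula L κ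
  | ex (V : Finset (Var κ)) (φ : PreFormula L κ) : PreFormula L κ

section

variable {L : RelSignature.{u}} {κ : Cardinal.{u}}

/-- The variables occurring in a term. -/
def Term.vars : Term L κ → Set (Var κ)
  | .var x => {x}
  | .const _ => ∅

/-- The constant symbols occurring in a term. -/
def Term.consts : Term L κ → Set L.Const
  | .var _ => ∅
  | .const c => {c}

namespace PreFormula

/-- The free variables of a pre-formula. -/
def freeVars : PreFormula L κ → Set (Var κ)
  | .eq t₁ t₂ => t₁.vars ∪ t₂.vars
  | .rel _ ts => ⋃ i, (ts i).vars
  | .neg φ => φ.freeVars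
  | .conj _ _ Φ => ⋃ i, (Φ i).freeVars
  | .disj _ _ Φ => ⋃ i, (Φ i).freeVars
  | .all V φ => φ.freeVars \ ↑V
  | .ex V φ => φ.freeVars \ ↑V

/-- The relation symbols occurring in a pre-formula. -/
def relSymbols : PreFormula L κ → Set L.Rel
  | .eq _ _ => ∅
  | .rel R _ => {R}
  | .neg φ => φ.relSymbols
  | .conj _ _ Φ => ⋃ i, (Φ i).relSymbols
  | .disj _ _ Φ => ⋃ i, (Φ i).relSymbols
  | .all _ φ => φ.relSymbols
  | .ex _ φ => φ.relSymbols

/-- The constant symbols occurring in a pre-formula. -/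
def constSymbols : PreFormula L κ → Set L.Const
  | .eq t₁ t₂ => t₁.consts ∪ t₂.consts
  | .rel _ ts => ⋃ i, (ts i).consts
  | .neg φ => φ.constSymbols
  | .conj _ _ Φ => ⋃ i, (Φ i).constSymbols
  | .disj _ _ Φ => ⋃ i, (Φ i).constSymbols
  | .all _ φ => φ.constSymbols
  | .ex _ φ => φ.constSymbols

/-- The pre-formula is an `L_{κω}`-formula: at every conjunction and disjunction in it, the free
variables of all the members together lie in a finite set. -/
def IsFormula : PreFormula L κ → Prop
  | .eq _ _ => True
  | .rel _ _ => True
  | .neg φ => φ.IsFormula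
  | .conj _ _ Φ => (∀ i, (Φ i).IsFormula) ∧ (⋃ i, (Φ i).freeVars).Finite
  | .disj _ _ Φ => (∀ i, (Φ i).IsFormula) ∧ (⋃ i, (Φ i).freeVars).Finite
  | .all _ φ => φ.IsFormula
  | .ex _ φ => φ.IsFormula

/-- An `L_{κω}`-sentence: an `L_{κω}`-formula without free variables. -/
def IsSentence (φ : PreFormula L κ) : Prop :=
  φ.IsFormula ∧ φ.freeVars = ∅

end PreFormula

theorem nonempty_embedding_of_lt {ι : Type u} (h : #ι < κ) : Nonempty (ι ↪ κ.ord.ToType) := by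
  have h' : #ι ≤ #κ.ord.ToType := by simpa using h.le
  exact h'

namespace PreFormula

/-- The disjunction of a family indexed by an arbitrary type with fewer than `κ` elements. -/
noncomputable def disjOf {ι : Type u} (h : #ι < κ) (Φ : ι → PreFormula L κ) : PreFormula L κ :=
  let e : ι ↪ κ.ord.ToType := Classical.choice (nonempty_embedding_of_lt h)
  .disj (Set.range e) (by rwa [Cardinal.mk_range_eq e e.injective])
    fun i => Φ ((Equiv.ofInjective e e.injective).symm i)

/-- The implication `φ → ψ`, an abbreviation for `⋁ {¬ φ, ψ}`. -/
noncomputable def imp (hκ : ℵ₀ ≤ κ) (φ ψ : PreFormula L κ) : PreFormula L κ :=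
  disjOf (ι := ULift.{u} Bool) ((Cardinal.lt_aleph0_of_finite _).trans_le hκ)
    fun b => if b.down then ψ else .neg φ

end PreFormula

end

/-- A `B`-valued model for `L`, where `B` is a complete Boolean algebra. -/
structure BooleanModel (L : RelSignature.{u}) (B : Type u) [CompleteBooleanAlgebra B] :
    Type (u + 1) where
  /-- the domain -/
  Carrier : Type u
  nonempty : Nonempty Carrier
  /-- the Boolean value of equality -/
  eqv : Carrier → Carrier → B
  /-- the Boolean value of each relation -/
  rel : (R : L.Rel) → (Fin (L.arity R) → Carrier) → B
  /-- the interpretation of the constants -/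
  const : L.Const → Carrier
  eqv_refl : ∀ τ, eqv τ τ = ⊤
  eqv_symm : ∀ τ σ, eqv τ σ = eqv σ τ
  eqv_trans : ∀ τ σ π, eqv τ σ ⊓ eqv σ π ≤ eqv τ π
  rel_congr : ∀ (R : L.Rel) (τ σ : Fin (L.arity R) → Carrier),
    (⨅ i, eqv (τ i) (σ i)) ⊓ rel R τ ≤ rel R σ

namespace BooleanModel

variable {L : RelSignature.{u}} {κ : Cardinal.{u}} {B : Type u} [CompleteBooleanAlgebra B]

/-- The mixing property. Antichains in a Boolean algebra are sets of pairwise disjoint elements. -/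
def Mixing (M : BooleanModel L B) : Prop :=
  ∀ (A : Set B), A.PairwiseDisjoint id → ∀ τ : A → M.Carrier,
    ∃ σ : M.Carrier, ∀ a : A, (a : B) ≤ M.eqv σ (τ a)

/-- The value of a term under an assignment. -/
def termVal (M : BooleanModel L B) (s : Var κ → M.Carrier) : Term L κ → M.Carrier
  | .var x => s x
  | .const c => M.const c

open Classical in
/-- The assignment `s[V ↦ a]`. -/
noncomputable def update {M : Type u} (s : Var κ → M) (V : Finset (Var κ)) (a : V → M) :
    Var κ → M :=
  fun x => if h : x ∈ V then a ⟨x, h⟩ else s x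

/-- The Boolean value of a pre-formula under an assignment. -/
noncomputable def val (M : BooleanModel L B) : PreFormula L κ → (Var κ → M.Carrier) → B
  | .eq t₁ t₂, s => M.eqv (M.termVal s t₁) (M.termVal s t₂)
  | .rel R ts, s => M.rel R fun i => M.termVal s (ts i)
  | .neg φ, s => (M.val φ s)ᶜ
  | .conj _ _ Φ, s => ⨅ i, M.val (Φ i) s
  | .disj _ _ Φ, s => ⨆ i, M.val (Φ i) s
  | .all V φ, s => ⨅ a : V → M.Carrier, M.val φ (update s V a)
  | .ex V φ, s => ⨆ a : V → M.Carrier, M.val φ (update s V a)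

theorem val_disjOf (M : BooleanModel L B) {ι : Type u} (h : #ι < κ) (Φ : ι → PreFormula L κ)
    (s : Var κ → M.Carrier) : M.val (PreFormula.disjOf h Φ) s = ⨆ i, M.val (Φ i) s := by
  simp only [PreFormula.disjOf, val]
  exact Equiv.iSup_comp (g := fun i => M.val (Φ i) s) (Equiv.symm _)

theorem val_imp (M : BooleanModel L B) (hκ : ℵ₀ ≤ κ) (φ ψ : PreFormula L κ)
    (s : Var κ → M.Carrier) :
    M.val (PreFormula.imp hκ φ ψ) s = (M.val φ s)ᶜ ⊔ M.val ψ s := by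
  rw [PreFormula.imp, val_disjOf, ← Equiv.ulift.symm.iSup_comp, iSup_bool_eq]
  simp [val, sup_comm]

end BooleanModel

/-- The relation `Γ ⊨_Sh Δ`: in every Boolean valued model with the mixing property over a complete
Boolean algebra, and under every assignment, the value of `⋀ Γ` is at most that of `⋁ Δ`. -/
def ShEntails {L : RelSignature.{u}} {κ : Cardinal.{u}} (Γ Δ : Set (PreFormula L κ)) : Prop :=
  ∀ (B : Type u) [CompleteBooleanAlgebra B] (M : BooleanModel L B), M.Mixing →
    ∀ s : Var κ → M.Carrier, (⨅ φ ∈ Γ, M.val φ s) ≤ ⨆ ψ ∈ Δ, M.val ψ s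

/-- Validity `⊨_Sh χ`. -/
def ShValid {L : RelSignature.{u}} {κ : Cardinal.{u}} (χ : PreFormula L κ) : Prop :=
  ShEntails ∅ {χ}

end RelSignature

/-! ### Regular elements of a frame -/

namespace Heyting.Regular

variable {α : Type*} [Order.Frame α]

/-! The proof is by contraposition, through a generic Boolean valued model. Suppose that no formula
in the common vocabulary separates `φ` from `¬ψ`. A condition is a pair of sets of formulas, one set
for each side, of finite support, that no such formula separates; larger sets are stronger. In the
complete Boolean algebra of regular lower sets of conditions, `force` sends a formula, on a given
side, to the conditions below which entailing it is dense.

Inseparability lets conditions grow. If a side entails a disjunction, some disjunct can be added,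
for otherwise the disjunction of the separators would separate (`Separates.exists_of_iSup`). If it
entails an existential statement, fresh variables can serve as witnesses
(`Separates.exists_of_iSup_update`). The two sides agree on the common vocabulary, since a formula
entailed on one side and refuted on the other is a separator (`force_eq_force`).

Hence the forced atomic values define a single Boolean valued structure on the variables. Adding all
Boolean valued singletons gives the mixing property, while quantifiers may still be computed over
variables. By `genericModel_val`, truth is forcing on each side. The condition `({φ}, {¬ψ})` then
lies in the values of both `φ` and `¬ψ`, contradicting `φ ≤ ψ`.

Formulas are carried with a renaming of variables, which acts as an environment and avoids
substitution under quantifiers. -/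

noncomputable instance : CompleteBooleanAlgebra (Regular α) where
  __ := (inferInstance : BooleanAlgebra (Regular α))
  sSup S := toRegular (sSup (Regular.val '' S))
  -- An infimum of regular elements is already regular; regularising only supplies the type.
  sInf S := toRegular (sInf (Regular.val '' S))
  isLUB_sSup S := by
    refine ⟨fun a ha => ?_, fun b hb => ?_⟩
    · exact (le_sSup (Set.mem_image_of_mem _ ha)).trans le_compl_compl
    · refine gi.gc.l_le (sSup_le ?_)
      rintro _ ⟨a, ha, rfl⟩
      exact hb ha
  isGLB_sInf S := by
    refine ⟨fun a ha => ?_, fun b hb => ?_⟩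
    · exact gi.gc.l_le (sInf_le (Set.mem_image_of_mem _ ha))
    · have h : (b : α) ≤ sInf (Regular.val '' S) := by
        refine le_sInf ?_
        rintro _ ⟨a, ha, rfl⟩
        exact hb ha
      exact h.trans le_compl_compl

end Heyting.Regular

/-! ### Regular lower sets of a preorder -/

theorem LowerSet.mem_compl_iff_forall_le {P : Type*} [Preorder P] (U : LowerSet P) (p : P) :
    p ∈ Uᶜ ↔ ∀ q ≤ p, q ∉ U := by
  rw [← LowerSet.Iic_le, le_compl_iff_disjoint_right, disjoint_iff_inf_le]
  constructor
  · intro h q hq hU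
    exact h ⟨hq, hU⟩
  · intro h q hq
    exact h q hq.1 hq.2

/-- The complete Boolean algebra of regular lower sets of a preorder. -/
abbrev RegularLowerSet (P : Type u) [Preorder P] : Type u := Heyting.Regular (LowerSet P)

namespace RegularLowerSet

variable {P : Type u} [Preorder P]

theorem mem_compl {a : RegularLowerSet P} {p : P} : p ∈ aᶜ.val ↔ ∀ q ≤ p, q ∉ a.val := by
  rw [Heyting.Regular.coe_compl, LowerSet.mem_compl_iff_forall_le]

theorem mem_toRegular {U : LowerSet P} {p : P} :
    p ∈ (Heyting.Regular.toRegular U).val ↔ ∀ q ≤ p, ∃ r ≤ q, r ∈ U := by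
  simp [Heyting.Regular.coe_toRegular, LowerSet.mem_compl_iff_forall_le]

theorem mem_of_le {a : RegularLowerSet P} {p q : P} (h : q ≤ p) (hp : p ∈ a.val) : q ∈ a.val :=
  a.val.lower h hp

theorem mem_of_le_of_mem {a b : RegularLowerSet P} (h : a ≤ b) {p : P} (hp : p ∈ a.val) :
    p ∈ b.val :=
  h hp

/-- A regular set contains every condition below which it is dense, so inclusions need only be
checked after passing to an extension. -/
theorem le_of_forall_mem_exists {a b : RegularLowerSet P}
    (h : ∀ p ∈ a.val, ∃ q ≤ p, q ∈ b.val) : a ≤ b := by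
  intro p hp
  rw [← Heyting.Regular.toRegular_coe b]
  exact mem_toRegular.2 fun q hq => h q (mem_of_le hq hp)

theorem notMem_bot (p : P) : p ∉ (⊥ : RegularLowerSet P).val := fun h => h

end RegularLowerSet

/-- Finite distributivity. It serves to represent finitely many Boolean points by elements of the
underlying set simultaneously. -/
theorem iSup_iInf_eq_top_of_finite {ι C B : Type*} [Finite ι] [Order.Frame B] (f : ι → C → B)
    (hf : ∀ i, ⨆ c, f i c = ⊤) : ⨆ a : ι → C, ⨅ i, f i (a i) = ⊤ := by
  classical
  cases nonempty_fintype ι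
  suffices h : ∀ s : Finset ι, Nonempty (ι → C) → ⨆ a : ι → C, ⨅ i ∈ s, f i (a i) = ⊤ by
    by_cases hC : Nonempty (ι → C)
    · simpa using h Finset.univ hC
    -- Here `C` is empty and `ι` is not, so `hf` gives `⊥ = ⊤` and `B` is trivial.
    · simp only [Classical.nonempty_pi, not_forall, not_nonempty_iff] at hC
      obtain ⟨i, hi⟩ := hC
      have := hf i
      rw [iSup_of_empty] at this
      have := subsingleton_of_bot_eq_top this
      exact Subsingleton.elim _ _
  intro s hC
  induction s using Finset.induction_on with
  | empty => simp
  | insert j s hj ih =>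
    rw [eq_top_iff]
    calc (⊤ : B) = (⨆ c, f j c) ⊓ ⨆ a : ι → C, ⨅ i ∈ s, f i (a i) := by rw [ih, hf, top_inf_eq]
      _ ≤ _ := ?_
    rw [iSup_inf_iSup]
    refine iSup_le fun ⟨c, a⟩ => le_iSup_of_le (Function.update a j c) ?_
    rw [Finset.iInf_insert]
    refine inf_le_inf (by simp) (le_iInf₂ fun i hi => (iInf₂_le i hi).trans_eq ?_)
    rw [Function.update_of_ne (by rintro rfl; exact hj hi)]

namespace RelSignature

variable {L : RelSignature.{u}} {κ : Cardinal.{u}} {B : Type u} [CompleteBooleanAlgebra B]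

/-! ### The completion of a Boolean valued set -/

/-- A Boolean valued equivalence relation. -/
structure BooleanEquiv (C : Type u) (B : Type u) [CompleteBooleanAlgebra B] where
  /-- the Boolean value of equality -/
  eqv : C → C → B
  refl : ∀ c, eqv c c = ⊤
  symm : ∀ c d, eqv c d = eqv d c
  trans : ∀ c d e, eqv c d ⊓ eqv d e ≤ eqv c e

variable {C : Type u}

/-- The Boolean valued singletons of a Boolean valued set. -/
structure BooleanPoint (E : BooleanEquiv C B) where
  /-- the Boolean value of membership -/
  toFun : C → B
  strict : ∀ c d, toFun c ⊓ toFun d ≤ E.eqv c d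
  extensional : ∀ c d, E.eqv c d ⊓ toFun c ≤ toFun d
  total : ⨆ c, toFun c = ⊤

namespace BooleanPoint

variable {E : BooleanEquiv C B}

/-- The point given by an element. -/
def of (E : BooleanEquiv C B) (c : C) : BooleanPoint E where
  toFun d := E.eqv c d
  strict d e := by rw [E.symm c d]; exact E.trans d c e
  extensional d e := by rw [inf_comm]; exact E.trans c d e
  total := top_le_iff.1 ((E.refl c).ge.trans (le_iSup (fun d => E.eqv c d) c))

/-- The Boolean value of equality of two points. -/
def eqv (f g : BooleanPoint E) : B := ⨆ c, f.toFun c ⊓ g.toFun c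

theorem eqv_inf_le (f g : BooleanPoint E) (c : C) : f.eqv g ⊓ f.toFun c ≤ g.toFun c := by
  rw [eqv, iSup_inf_eq]
  refine iSup_le fun d => ?_
  calc f.toFun d ⊓ g.toFun d ⊓ f.toFun c = f.toFun d ⊓ f.toFun c ⊓ g.toFun d := by
        rw [inf_right_comm]
    _ ≤ E.eqv d c ⊓ g.toFun d := inf_le_inf_right _ (f.strict d c)
    _ ≤ g.toFun c := g.extensional d c

theorem eqv_symm (f g : BooleanPoint E) : f.eqv g = g.eqv f := by simp only [eqv, inf_comm]

theorem eqv_of (f : BooleanPoint E) (c : C) : f.eqv (of E c) = f.toFun c := by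
  apply le_antisymm
  · rw [eqv_symm]
    refine le_trans ?_ (eqv_inf_le (of E c) f c)
    exact le_inf le_rfl (le_top.trans_eq (E.refl c).symm)
  · exact le_trans (le_inf le_rfl (le_top.trans_eq (E.refl c).symm))
      (le_iSup (fun d => f.toFun d ⊓ (of E c).toFun d) c)

end BooleanPoint

/-- The model whose elements are the points of a Boolean valued set. -/
def completion [Nonempty C] (E : BooleanEquiv C B) (r : ∀ R : L.Rel, (Fin (L.arity R) → C) → B)
    (k : L.Const → BooleanPoint E) : BooleanModel L B where
  Carrier := BooleanPoint E
  nonempty := ⟨BooleanPoint.of E (Classical.arbitrary C)⟩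
  eqv := BooleanPoint.eqv
  rel R f := ⨆ c : Fin (L.arity R) → C, (⨅ i, (f i).toFun (c i)) ⊓ r R c
  const := k
  eqv_refl f := by simpa [BooleanPoint.eqv] using f.total
  eqv_symm := BooleanPoint.eqv_symm
  eqv_trans f g h := by
    rw [inf_comm, BooleanPoint.eqv, BooleanPoint.eqv, inf_iSup_eq]
    refine iSup_mono fun c => ?_
    refine le_inf (inf_le_right.trans inf_le_left) ?_
    exact le_trans (inf_le_inf_left _ inf_le_right) (g.eqv_inf_le h c)
  rel_congr R f g := by
    rw [inf_iSup_eq]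
    refine iSup_mono fun c => le_inf (le_iInf fun i => ?_) (inf_le_right.trans inf_le_right)
    refine le_trans ?_ ((f i).eqv_inf_le (g i) (c i))
    exact inf_le_inf (iInf_le _ i) (inf_le_left.trans (iInf_le _ i))

theorem completion_mixing [Nonempty C] (E : BooleanEquiv C B)
    (r : ∀ R : L.Rel, (Fin (L.arity R) → C) → B) (k : L.Const → BooleanPoint E) :
    (completion E r k).Mixing := by
  intro A hA τ
  change A → BooleanPoint E at τ
  let o := BooleanPoint.of E (Classical.arbitrary C)
  -- The complement of `⨆ a` completes `A` to a partition of unity, and the arbitrary point `o` is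
  -- used there; this makes the mixture `σ` total.
  let w : Option A → B := fun x => x.elim (⨆ a : A, (a : B))ᶜ fun a => (a : B)
  let t : Option A → BooleanPoint E := fun x => x.elim o τ
  have hw : ⨆ x, w x = ⊤ := by rw [iSup_option]; exact compl_sup_eq_top
  have hd : ∀ x y, x ≠ y → w x ⊓ w y ≤ ⊥ := by
    have h0 : ∀ a : A, (a : B) ⊓ (⨆ a : A, (a : B))ᶜ ≤ ⊥ := fun a =>
      (inf_le_inf_right _ (le_iSup (fun a : A => (a : B)) a)).trans_eq (inf_compl_self _)
    rintro (_ | a) (_ | b) hab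
    · exact absurd rfl hab
    · exact (inf_comm _ _).trans_le (h0 b)
    · exact h0 a
    · exact (hA a.2 b.2 fun h => hab (congrArg some (Subtype.ext h))).le_bot
  let σ : BooleanPoint E :=
    { toFun := fun c => ⨆ x, w x ⊓ (t x).toFun c
      strict := fun c d => by
        rw [iSup_inf_iSup]
        refine iSup_le fun ⟨x, y⟩ => ?_
        by_cases hxy : x = y
        · subst hxy
          exact (inf_le_inf inf_le_right inf_le_right).trans ((t x).strict c d)
        · exact ((inf_le_inf inf_le_left inf_le_left).trans (hd x y hxy)).trans bot_le
      extensional := fun c d => by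
        rw [inf_iSup_eq]
        refine iSup_mono fun x => le_inf (inf_le_right.trans inf_le_left) ?_
        exact (inf_le_inf_left _ inf_le_right).trans ((t x).extensional c d)
      total := by
        rw [iSup_comm]
        simp_rw [← inf_iSup_eq, (t _).total, inf_top_eq]
        exact hw }
  refine ⟨σ, fun a => ?_⟩
  change (a : B) ≤ ⨆ c, σ.toFun c ⊓ (τ a).toFun c
  calc (a : B) = ⨆ c, (a : B) ⊓ (τ a).toFun c := by rw [← inf_iSup_eq, (τ a).total, inf_top_eq]
    _ ≤ _ := iSup_mono fun c => le_inf (le_iSup (fun x => w x ⊓ (t x).toFun c) (some a))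
      inf_le_right

/-! ### Dependence of values on assignments -/

namespace BooleanModel

theorem update_comp {M N : Type u} (g : M → N) (s : Var κ → M) (V : Finset (Var κ)) (a : V → M) :
    g ∘ update s V a = update (g ∘ s) V (g ∘ a) := by
  funext x
  simp only [update, Function.comp]
  split_ifs <;> rfl

variable (M : BooleanModel L B)

theorem iInf_eqv_update_le (s s' : Var κ → M.Carrier) (V : Finset (Var κ)) (a a' : V → M.Carrier) :
    (⨅ x, M.eqv (s x) (s' x)) ⊓ (⨅ x, M.eqv (a x) (a' x)) ≤
      ⨅ x, M.eqv (update s V a x) (update s' V a' x) := by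
  refine le_iInf fun x => ?_
  simp only [update]
  split_ifs with h
  · exact inf_le_right.trans (iInf_le _ _)
  · exact inf_le_left.trans (iInf_le _ _)

theorem iInf_eqv_le_eqv_termVal (s s' : Var κ → M.Carrier) (t : Term L κ) :
    ⨅ x, M.eqv (s x) (s' x) ≤ M.eqv (M.termVal s t) (M.termVal s' t) := by
  cases t with
  | var x => exact iInf_le _ x
  | const c => exact le_top.trans_eq (M.eqv_refl _).symm

theorem val_congr (φ : PreFormula L κ) (s s' : Var κ → M.Carrier) :
    (⨅ x, M.eqv (s x) (s' x)) ⊓ M.val φ s ≤ M.val φ s' := by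
  have hupd : ∀ (s s' : Var κ → M.Carrier) (V : Finset (Var κ)) (a : V → M.Carrier),
      (⨅ x, M.eqv (s x) (s' x)) ≤ ⨅ x, M.eqv (update s V a x) (update s' V a x) := by
    intro s s' V a
    refine le_trans (le_inf le_rfl ?_) (M.iInf_eqv_update_le s s' V a a)
    simp [M.eqv_refl]
  induction φ generalizing s s' with
  | eq t₁ t₂ =>
    have h₁ := M.iInf_eqv_le_eqv_termVal s s' t₁
    have h₂ := M.iInf_eqv_le_eqv_termVal s s' t₂
    rw [M.eqv_symm] at h₁
    refine le_trans (le_inf (inf_le_left.trans h₁) (le_inf inf_le_right (inf_le_left.trans h₂))) ?_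
    exact (inf_le_inf_left _ (M.eqv_trans _ _ _)).trans (M.eqv_trans _ _ _)
  | rel R ts =>
    refine le_trans (inf_le_inf_right _ (le_iInf fun i => ?_)) (M.rel_congr R _ _)
    exact M.iInf_eqv_le_eqv_termVal s s' (ts i)
  | neg φ ih =>
    simp only [val]
    rw [le_compl_iff_disjoint_right, disjoint_iff_inf_le]
    have h := ih s' s
    simp only [M.eqv_symm (s' _)] at h
    calc _ = (M.val φ s)ᶜ ⊓ ((⨅ x, M.eqv (s x) (s' x)) ⊓ M.val φ s') := by
          rw [inf_comm (⨅ x, M.eqv (s x) (s' x)), inf_assoc]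
      _ ≤ (M.val φ s)ᶜ ⊓ M.val φ s := inf_le_inf_left _ h
      _ = ⊥ := compl_inf_self _
  | conj I hI Φ ih =>
    simp only [val]
    exact le_iInf fun i => (inf_le_inf_left _ (iInf_le _ i)).trans (ih i s s')
  | disj I hI Φ ih =>
    simp only [val, inf_iSup_eq]
    exact iSup_mono fun i => ih i s s'
  | all V φ ih =>
    simp only [val]
    exact le_iInf fun a => (inf_le_inf (hupd s s' V a) (iInf_le _ a)).trans (ih _ _)
  | ex V φ ih =>
    simp only [val, inf_iSup_eq]
    exact iSup_mono fun a => (inf_le_inf_right _ (hupd s s' V a)).trans (ih _ _)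

theorem termVal_eq_of_eqOn {s s' : Var κ → M.Carrier} {t : Term L κ} (h : Set.EqOn s s' t.vars) :
    M.termVal s t = M.termVal s' t := by
  cases t with
  | var x => exact h rfl
  | const c => rfl

theorem val_eq_of_eqOn {φ : PreFormula L κ} {s s' : Var κ → M.Carrier}
    (h : Set.EqOn s s' φ.freeVars) : M.val φ s = M.val φ s' := by
  have hupd : ∀ {F : Set (Var κ)} {s s' : Var κ → M.Carrier} {V : Finset (Var κ)}
      (a : V → M.Carrier), Set.EqOn s s' (F \ V) → Set.EqOn (update s V a) (update s' V a) F := by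
    intro F s s' V a h x hx
    simp only [update]
    split_ifs with hV
    · rfl
    · exact h ⟨hx, hV⟩
  induction φ generalizing s s' with
  | eq t₁ t₂ =>
    simp only [val]
    rw [M.termVal_eq_of_eqOn (h.mono Set.subset_union_left),
      M.termVal_eq_of_eqOn (h.mono Set.subset_union_right)]
  | rel R ts =>
    simp only [val]
    congr 1
    funext i
    exact M.termVal_eq_of_eqOn (h.mono (Set.subset_iUnion (fun i => (ts i).vars) i))
  | neg φ ih => simp only [val, ih h]
  | conj I hI Φ ih =>
    simp only [val]
    exact iInf_congr fun i => ih i (h.mono (Set.subset_iUnion (fun i => (Φ i).freeVars) i))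
  | disj I hI Φ ih =>
    simp only [val]
    exact iSup_congr fun i => ih i (h.mono (Set.subset_iUnion (fun i => (Φ i).freeVars) i))
  | all V φ ih =>
    simp only [val]
    exact iInf_congr fun a => ih (hupd a h)
  | ex V φ ih =>
    simp only [val]
    exact iSup_congr fun a => ih (hupd a h)

end BooleanModel

/-! ### Quantifiers in the completion -/

section

variable [Nonempty C] {E : BooleanEquiv C B} {r : ∀ R : L.Rel, (Fin (L.arity R) → C) → B}
  {k : L.Const → BooleanPoint E}

variable (E r k) in
/-- The canonical map into the completion. -/
def completionOf (c : C) : (completion E r k).Carrier := BooleanPoint.of E c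

/-- A tuple `f` of points equals a tuple `a` from `C` with value `⨅ i, f i (a i)`, and these values
cover `⊤` because `V` is finite. With `val_congr`, quantifiers over points thus reduce to
quantifiers over `C`. -/
theorem completion_iSup_eqv_of (V : Finset (Var κ)) (f : V → (completion E r k).Carrier)
    (s : Var κ → C) :
    ⨆ a : V → C, ⨅ x, (completion E r k).eqv (BooleanModel.update (completionOf E r k ∘ s) V f x)
      ((completionOf E r k ∘ BooleanModel.update s V a) x) = ⊤ := by
  rw [eq_top_iff, ← iSup_iInf_eq_top_of_finite (fun i => BooleanPoint.toFun (f i))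
    fun i => BooleanPoint.total (f i)]
  refine iSup_mono fun a => ?_
  rw [BooleanModel.update_comp]
  refine le_trans (le_inf (le_iInf fun x => ?_) (le_iInf fun x => ?_))
    ((completion E r k).iInf_eqv_update_le _ _ V f _)
  · exact le_top.trans_eq ((completion E r k).eqv_refl _).symm
  · exact (iInf_le _ x).trans_eq (BooleanPoint.eqv_of (f x) (a x)).symm

theorem completion_val_ex (φ : PreFormula L κ) (V : Finset (Var κ)) (s : Var κ → C) :
    (completion E r k).val (.ex V φ) (completionOf E r k ∘ s) =
      ⨆ a : V → C, (completion E r k).val φ (completionOf E r k ∘ BooleanModel.update s V a) := by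
  apply le_antisymm
  · refine iSup_le fun f => ?_
    rw [← top_inf_eq ((completion E r k).val φ _), ← completion_iSup_eqv_of V f s, iSup_inf_eq]
    exact iSup_mono fun a => (completion E r k).val_congr φ _ _
  · refine iSup_le fun a => ?_
    rw [BooleanModel.update_comp]
    exact le_iSup (fun f => (completion E r k).val φ
      (BooleanModel.update (completionOf E r k ∘ s) V f)) (completionOf E r k ∘ a)

theorem completion_val_all (φ : PreFormula L κ) (V : Finset (Var κ)) (s : Var κ → C) :
    (completion E r k).val (.all V φ) (completionOf E r k ∘ s) =
      ⨅ a : V → C, (completion E r k).val φ (completionOf E r k ∘ BooleanModel.update s V a) := by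
  apply le_antisymm
  · refine le_iInf fun a => ?_
    rw [BooleanModel.update_comp]
    exact iInf_le (fun f => (completion E r k).val φ
      (BooleanModel.update (completionOf E r k ∘ s) V f)) (completionOf E r k ∘ a)
  · refine le_iInf fun f => ?_
    rw [← top_inf_eq (⨅ a : V → C, _), ← completion_iSup_eqv_of V f s, iSup_inf_eq]
    refine iSup_le fun a => (inf_le_inf_left _ (iInf_le _ a)).trans ?_
    simp_rw [(completion E r k).eqv_symm (BooleanModel.update (completionOf E r k ∘ s) V f _)]
    exact (completion E r k).val_congr φ _ _

end

end RelSignature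

namespace RelSignature

variable {L : RelSignature.{u}} {κ : Cardinal.{u}}

/-! ### Vocabularies and free variables -/

/-- The non-logical symbols occurring in a pre-formula. -/
def PreFormula.vocabulary (φ : PreFormula L κ) : Set L.Rel × Set L.Const :=
  (φ.relSymbols, φ.constSymbols)

namespace PreFormula

theorem IsFormula.finite_freeVars {φ : PreFormula L κ} (h : φ.IsFormula) : φ.freeVars.Finite := by
  have ht : ∀ t : Term L κ, t.vars.Finite := by
    rintro (x | c)
    · exact Set.finite_singleton x
    · exact Set.finite_empty
  induction φ with
  | eq t₁ t₂ => exact (ht t₁).union (ht t₂)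
  | rel R ts => exact Set.finite_iUnion fun i => ht (ts i)
  | neg φ ih => exact ih h
  | conj I hI Φ ih => exact h.2
  | disj I hI Φ ih => exact h.2
  | all V φ ih => exact (ih h).sdiff
  | ex V φ ih => exact (ih h).sdiff

section disjOf

variable {ι : Type u} (h : #ι < κ) (Φ : ι → PreFormula L κ)

theorem isFormula_disjOf (h₁ : ∀ i, (Φ i).IsFormula) (h₂ : (⋃ i, (Φ i).freeVars).Finite) :
    (disjOf h Φ).IsFormula :=
  ⟨fun _ => h₁ _, h₂.subset (Set.iUnion_subset fun _ =>
    Set.subset_iUnion (fun i => (Φ i).freeVars) _)⟩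

theorem vocabulary_disjOf_le {Λ : Set L.Rel × Set L.Const} (h₁ : ∀ i, (Φ i).vocabulary ≤ Λ) :
    (disjOf h Φ).vocabulary ≤ Λ :=
  ⟨Set.iUnion_subset fun _ => (h₁ _).1, Set.iUnion_subset fun _ => (h₁ _).2⟩

end disjOf

end PreFormula

/-! ### Closures -/

/-- A pre-formula together with a renaming of its variables. -/
abbrev Closure (L : RelSignature.{u}) (κ : Cardinal.{u}) : Type u :=
  PreFormula L κ × (Var κ → Var κ)

namespace Closure

/-- The variables on which the value of a closure depends. -/
def support (x : Closure L κ) : Set (Var κ) := x.2 '' x.1.freeVars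

/-- The negation of a closure. -/
def neg (x : Closure L κ) : Closure L κ := (.neg x.1, x.2)

end Closure

/-- The variables on which the value of a set of closures depends. -/
def support (l : Set (Closure L κ)) : Set (Var κ) := ⋃ x ∈ l, x.support

theorem support_insert (x : Closure L κ) (l : Set (Closure L κ)) :
    support (insert x l) = x.support ∪ support l := by
  simp [support]

namespace BooleanModel

variable {B : Type u} [CompleteBooleanAlgebra B] (M : BooleanModel L B)

/-- The value of a closure. -/
noncomputable def closureVal (s : Var κ → M.Carrier) (x : Closure L κ) : B := M.val x.1 (s ∘ x.2)

theorem closureVal_neg (s : Var κ → M.Carrier) (x : Closure L κ) :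
    M.closureVal s x.neg = (M.closureVal s x)ᶜ := rfl

/-- The value of the conjunction of a set of closures. -/
noncomputable def setVal (s : Var κ → M.Carrier) (l : Set (Closure L κ)) : B :=
  ⨅ x ∈ l, M.closureVal s x

theorem setVal_insert (s : Var κ → M.Carrier) (x : Closure L κ) (l : Set (Closure L κ)) :
    M.setVal s (insert x l) = M.closureVal s x ⊓ M.setVal s l := iInf_insert

theorem setVal_anti (s : Var κ → M.Carrier) {l l' : Set (Closure L κ)} (h : l ⊆ l') :
    M.setVal s l' ≤ M.setVal s l := biInf_mono h

theorem setVal_eq_of_eqOn {l : Set (Closure L κ)} {s s' : Var κ → M.Carrier}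
    (h : Set.EqOn s s' (support l)) : M.setVal s l = M.setVal s' l := by
  refine iInf_congr fun x => iInf_congr fun hx => M.val_eq_of_eqOn fun y hy => h ?_
  exact Set.mem_biUnion hx (Set.mem_image_of_mem _ hy)

theorem update_eqOn {N : Type u} (s : Var κ → N) (V : Finset (Var κ)) (a : V → N)
    {F : Set (Var κ)} (h : Disjoint (V : Set (Var κ)) F) : Set.EqOn s (update s V a) F := by
  intro x hx
  have : x ∉ V := fun hV => Set.disjoint_left.1 h hV hx
  simp [update, this]

end BooleanModel

open BooleanModel

/-- Semantic consequence from a set of closures, in models with the mixing property. -/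
def Entails (l : Set (Closure L κ)) (x : Closure L κ) : Prop :=
  ∀ (B : Type u) [CompleteBooleanAlgebra B] (M : BooleanModel L B), M.Mixing →
    ∀ s : Var κ → M.Carrier, M.setVal s l ≤ M.closureVal s x

theorem entails_of_mem {l : Set (Closure L κ)} {x : Closure L κ} (h : x ∈ l) : Entails l x :=
  fun _ _ _ _ _ => iInf₂_le x h

theorem Entails.mono {l l' : Set (Closure L κ)} {x : Closure L κ} (h : Entails l x) (hl : l ⊆ l') :
    Entails l' x :=
  fun B _ M hM s => (M.setVal_anti s hl).trans (h B M hM s)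

/-- The formula `θ` with symbols from `Λ` separates `l` from `r`. -/
structure Separates (Λ : Set L.Rel × Set L.Const) (l r : Set (Closure L κ))
    (θ : PreFormula L κ) : Prop where
  isFormula : θ.IsFormula
  vocabulary_le : θ.vocabulary ≤ Λ
  left : Entails l (θ, id)
  right : Entails r (.neg θ, id)

/-! ### Combining separating formulas -/

section Separation

variable {Λ : Set L.Rel × Set L.Const} {l r : Set (Closure L κ)} {θ : PreFormula L κ}

theorem Separates.symm (h : Separates Λ l r θ) : Separates Λ r l (.neg θ) where
  isFormula := h.isFormula
  vocabulary_le := h.vocabulary_le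
  left := h.right
  right B _ M hM s := by
    have := h.left B M hM s
    simpa [closureVal, val] using this

/-- Quantify universally over the unwanted variables: `l` does not depend on them, so it still
entails the result, which is stronger than `θ` and so still excludes `r`. -/
theorem Separates.exists_freeVars_subset (h : Separates Λ l r θ) {F : Set (Var κ)}
    (hF : support l ⊆ F) : ∃ θ', Separates Λ l r θ' ∧ θ'.freeVars ⊆ F := by
  classical
  let W : Finset (Var κ) := (h.isFormula.finite_freeVars.sdiff (t := F)).toFinset
  have hW : (W : Set (Var κ)) = θ.freeVars \ F := by simp [W]
  refine ⟨.all W θ, ⟨h.isFormula, h.vocabulary_le, fun B _ M hM s => ?_, fun B _ M hM s => ?_⟩, ?_⟩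
  · refine le_iInf fun a => ?_
    rw [M.setVal_eq_of_eqOn (s' := update s W a)]
    · exact h.left B M hM _
    · apply update_eqOn
      rw [hW]
      exact Set.disjoint_sdiff_left.mono_right hF
  · refine (h.right B M hM s).trans (compl_le_compl ?_)
    -- Instantiating the quantifier by the values of `s` itself leaves the assignment unchanged.
    refine (iInf_le (fun a => M.val θ (update s W a)) fun x => s x).trans_eq ?_
    congr 1
    funext x
    simp [update]
  · intro x hx
    by_contra hxF
    apply hx.2
    rw [hW]
    exact ⟨hx.1, hxF⟩

/-- The disjunction of the separators separates. It is a formula only once their free variables lie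
in one finite set, which `exists_freeVars_subset` arranges. -/
theorem Separates.exists_of_iSup {ι : Type u} (hι : #ι < κ) (x : ι → Closure L κ)
    (hx : (⋃ i, (x i).support).Finite) (hl : (support l).Finite)
    (h : ∀ i, ∃ θ, Separates Λ (insert (x i) l) r θ)
    (hs : ∀ (B : Type u) [CompleteBooleanAlgebra B] (M : BooleanModel L B), M.Mixing →
      ∀ s : Var κ → M.Carrier, M.setVal s l ≤ ⨆ i, M.closureVal s (x i)) :
    ∃ θ, Separates Λ l r θ := by
  have h' : ∀ i, ∃ θ, Separates Λ (insert (x i) l) r θ ∧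
      θ.freeVars ⊆ (⋃ i, (x i).support) ∪ support l := by
    intro i
    obtain ⟨θ, hθ⟩ := h i
    refine hθ.exists_freeVars_subset ?_
    rw [support_insert]
    exact Set.union_subset_union_left _ (Set.subset_iUnion (fun i => (x i).support) i)
  choose θ hθ hF using h'
  refine ⟨.disjOf hι θ, PreFormula.isFormula_disjOf hι θ (fun i => (hθ i).isFormula)
    ((hx.union hl).subset (Set.iUnion_subset hF)),
    PreFormula.vocabulary_disjOf_le hι θ fun i => (hθ i).vocabulary_le,
    fun B _ M hM s => ?_, fun B _ M hM s => ?_⟩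
  · simp only [closureVal, val_disjOf]
    refine (le_inf (hs B M hM s) le_rfl).trans ?_
    rw [iSup_inf_eq]
    refine iSup_mono fun i => ?_
    rw [← setVal_insert]
    exact (hθ i).left B M hM s
  · simp only [closureVal, val, val_disjOf, compl_iSup]
    exact le_iInf fun i => (hθ i).right B M hM s

theorem infinite_var (hκ : ℵ₀ ≤ κ) : Infinite (Var κ) := by
  rw [Cardinal.infinite_iff]
  simpa using hκ

theorem exists_injective_notMem (hκ : ℵ₀ ≤ κ) (V : Finset (Var κ)) {F : Set (Var κ)}
    (hF : F.Finite) : ∃ a : V → Var κ, Function.Injective a ∧ ∀ x, a x ∉ F := by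
  have := infinite_var hκ
  have := hF.infinite_compl.to_subtype
  let f : V ↪ ↥Fᶜ := (Fintype.equivFin V).toEmbedding.trans
    (Fin.valEmbedding.trans (Infinite.natEmbedding ↥Fᶜ))
  exact ⟨fun x => f x, fun x y h => f.injective (Subtype.ext h), fun x => (f x).2⟩

/-- Choose distinct fresh witnesses `a` and take a separator `θ` for them. As neither side mentions
these variables, `θ` quantified existentially over them separates `l` from `r`. -/
theorem Separates.exists_of_iSup_update (hκ : ℵ₀ ≤ κ) (χ : PreFormula L κ)
    (hχ : χ.freeVars.Finite) (e : Var κ → Var κ) (V : Finset (Var κ))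
    (hl : (support l).Finite) (hr : (support r).Finite)
    (h : ∀ a : V → Var κ, ∃ θ, Separates Λ (insert (χ, update e V a) l) r θ)
    (hs : ∀ (B : Type u) [CompleteBooleanAlgebra B] (M : BooleanModel L B), M.Mixing →
      ∀ s : Var κ → M.Carrier, M.setVal s l ≤
        ⨆ m : V → M.Carrier, M.val χ (update (s ∘ e) V m)) :
    ∃ θ, Separates Λ l r θ := by
  classical
  obtain ⟨a, ha, haF⟩ := exists_injective_notMem hκ V ((hl.union hr).union (hχ.image e))
  obtain ⟨θ, hθ⟩ := h a
  let W : Finset (Var κ) := Finset.univ.image a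
  have hW : Disjoint (W : Set (Var κ)) (support l ∪ support r ∪ e '' χ.freeVars) := by
    rw [Set.disjoint_left]
    intro y hy
    obtain ⟨x, -, rfl⟩ := Finset.mem_image.1 hy
    exact haF x
  refine ⟨.ex W θ, hθ.isFormula, hθ.vocabulary_le, fun B _ M hM s => ?_, fun B _ M hM s => ?_⟩
  · refine (le_inf (hs B M hM s) le_rfl).trans ?_
    rw [iSup_inf_eq]
    refine iSup_le fun m => ?_
    have := M.nonempty
    -- The witnesses `m` are moved along the injection `a`; the default value is never met, as `W`
    -- is the range of `a`.
    let n : W → M.Carrier := fun w => Function.extend a m (fun _ => Classical.arbitrary _) w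
    refine le_iSup_of_le n ?_
    have hn : ∀ x, update s W n (a x) = m x := by
      intro x
      have : a x ∈ W := Finset.mem_image_of_mem _ (Finset.mem_univ x)
      simp [update, this, n, ha.extend_apply]
    have hup := update_eqOn s W n hW
    -- On `V` both assignments give `m`; at any other free variable `x` of `χ`, `e x` lies outside
    -- `W`.
    have h₁ : M.val χ (update (s ∘ e) V m) = M.val χ (update s W n ∘ update e V a) := by
      apply M.val_eq_of_eqOn
      intro x hx
      rw [update_comp]
      by_cases hV : x ∈ V
      · simp [update, hV] at hn ⊢
        exact (hn x hV).symm
      · have := hup (Or.inr (Set.mem_image_of_mem e hx))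
        simpa [update, hV] using this
    rw [h₁, M.setVal_eq_of_eqOn (hup.mono fun x hx => Or.inl (Or.inl hx))]
    have := hθ.left B M hM (update s W n)
    rwa [setVal_insert] at this
  · simp only [closureVal, val, compl_iSup]
    refine le_iInf fun n => ?_
    rw [M.setVal_eq_of_eqOn ((update_eqOn s W n hW).mono fun x hx => Or.inl (Or.inr hx))]
    exact hθ.right B M hM _

end Separation

/-! ### Conditions -/

/-- The conditions: pairs of sets of closures, of finite support, that no formula in the common
vocabulary separates. -/
def Condition (L : RelSignature.{u}) (κ : Cardinal.{u}) (Λ : Bool → Set L.Rel × Set L.Const) :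
    Type u :=
  {p : Bool → Set (Closure L κ) // (∀ b, (support (p b)).Finite) ∧
    ¬ ∃ θ, Separates (Λ true ⊓ Λ false) (p true) (p false) θ}

namespace Condition

variable {Λ : Bool → Set L.Rel × Set L.Const}

instance : Preorder (Condition L κ Λ) where
  le p q := ∀ b, q.1 b ⊆ p.1 b
  le_refl p b := subset_rfl
  le_trans p q r h₁ h₂ b := (h₂ b).trans (h₁ b)

theorem not_separates (p : Condition L κ Λ) (b : Bool) (θ : PreFormula L κ) :
    ¬ Separates (Λ true ⊓ Λ false) (p.1 b) (p.1 !b) θ := by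
  intro h
  cases b
  · exact p.2.2 ⟨_, h.symm⟩
  · exact p.2.2 ⟨θ, h⟩

theorem exists_le_mem (p : Condition L κ Λ) (b : Bool) (x : Closure L κ) (hx : x.support.Finite)
    (h : ¬ ∃ θ, Separates (Λ true ⊓ Λ false) (insert x (p.1 b)) (p.1 !b) θ) :
    ∃ q ≤ p, x ∈ q.1 b := by
  classical
  refine ⟨⟨Function.update p.1 b (insert x (p.1 b)), ?_, ?_⟩, ?_, ?_⟩
  · intro b'
    by_cases hb : b' = b
    · subst hb
      rw [Function.update_self, support_insert]
      exact hx.union (p.2.1 b')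
    · rw [Function.update_of_ne hb]
      exact p.2.1 b'
  · rintro ⟨θ, hθ⟩
    cases b
    · exact h ⟨_, by simpa using hθ.symm⟩
    · exact h ⟨θ, by simpa using hθ⟩
  · intro b'
    by_cases hb : b' = b
    · subst hb
      simp
    · simp [Function.update_of_ne hb]
  · simp

theorem exists_le_of_iSup (p : Condition L κ Λ) (b : Bool) {ι : Type u} (hι : #ι < κ)
    (x : ι → Closure L κ) (hx : (⋃ i, (x i).support).Finite)
    (hs : ∀ (B : Type u) [CompleteBooleanAlgebra B] (M : BooleanModel L B), M.Mixing →
      ∀ s : Var κ → M.Carrier, M.setVal s (p.1 b) ≤ ⨆ i, M.closureVal s (x i)) :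
    ∃ i, ∃ q ≤ p, x i ∈ q.1 b := by
  by_contra! hc
  obtain ⟨θ, hθ⟩ := Separates.exists_of_iSup (Λ := Λ true ⊓ Λ false) (r := p.1 !b) hι x hx (p.2.1 b)
    (fun i => by
      by_contra h
      obtain ⟨q, hq, hxq⟩ := p.exists_le_mem b (x i)
        (hx.subset (Set.subset_iUnion (fun i => (x i).support) i)) h
      exact hc i q hq hxq) hs
  exact p.not_separates b θ hθ

theorem exists_le_of_iSup_update (hκ : ℵ₀ ≤ κ) (p : Condition L κ Λ) (b : Bool)
    (χ : PreFormula L κ) (hχ : χ.freeVars.Finite) (e : Var κ → Var κ) (V : Finset (Var κ))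
    (hs : ∀ (B : Type u) [CompleteBooleanAlgebra B] (M : BooleanModel L B), M.Mixing →
      ∀ s : Var κ → M.Carrier, M.setVal s (p.1 b) ≤
        ⨆ m : V → M.Carrier, M.val χ (update (s ∘ e) V m)) :
    ∃ a : V → Var κ, ∃ q ≤ p, (χ, update e V a) ∈ q.1 b := by
  by_contra! hc
  obtain ⟨θ, hθ⟩ := Separates.exists_of_iSup_update (Λ := Λ true ⊓ Λ false) (r := p.1 !b) hκ χ hχ
    e V (p.2.1 b) (p.2.1 !b) (fun a => by
      by_contra h
      obtain ⟨q, hq, hxq⟩ := p.exists_le_mem b (χ, update e V a) (hχ.image _) h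
      exact hc a q hq hxq) hs
  exact p.not_separates b θ hθ

theorem exists_le_decide (hκ : ℵ₀ ≤ κ) (p : Condition L κ Λ) (b : Bool) (x : Closure L κ)
    (hx : x.support.Finite) : ∃ q ≤ p, x ∈ q.1 b ∨ x.neg ∈ q.1 b := by
  obtain ⟨⟨i⟩, q, hq, h⟩ := p.exists_le_of_iSup b (ι := ULift.{u} Bool)
    ((Cardinal.lt_aleph0_of_finite _).trans_le hκ) (fun i => if i.down then x else x.neg)
    (Set.finite_iUnion fun i => by
      split_ifs
      · exact hx
      · exact hx)
    (fun B _ M hM s => by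
      rw [← Equiv.ulift.symm.iSup_comp, iSup_bool_eq]
      simp [closureVal_neg])
  refine ⟨q, hq, ?_⟩
  cases i
  · exact Or.inr h
  · exact Or.inl h

theorem not_entails_neg (hκ : ℵ₀ ≤ κ) (p : Condition L κ Λ) (b : Bool) (x : Closure L κ)
    (h₁ : Entails (p.1 b) x) (h₂ : Entails (p.1 b) x.neg) : False := by
  -- The empty disjunction: an inconsistent side would be separated from the other by falsity.
  obtain ⟨⟨⟩, -⟩ := p.exists_le_of_iSup b (ι := PEmpty)
    ((Cardinal.lt_aleph0_of_finite _).trans_le hκ) (fun _ => x) (by simp)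
    (fun B _ M hM s => by
      refine (le_inf (h₁ B M hM s) (h₂ B M hM s)).trans ?_
      simp [closureVal_neg])

end Condition

end RelSignature

namespace RelSignature

variable {L : RelSignature.{u}} {κ : Cardinal.{u}}

open BooleanModel RegularLowerSet

/-! ### The generic model -/

section Forcing

variable {Λ : Bool → Set L.Rel × Set L.Const}

/-- The regular set of conditions that densely entail a closure on the side `b`. -/
noncomputable def force (Λ : Bool → Set L.Rel × Set L.Const) (b : Bool) (x : Closure L κ) :
    RegularLowerSet (Condition L κ Λ) :=
  Heyting.Regular.toRegular ⟨{p | Entails (p.1 b) x}, fun _ _ h hp => hp.mono (h b)⟩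

theorem mem_force {b : Bool} {x : Closure L κ} {p : Condition L κ Λ} :
    p ∈ (force Λ b x).val ↔ ∀ q ≤ p, ∃ r ≤ q, Entails (r.1 b) x :=
  mem_toRegular

theorem mem_force_of_entails {b : Bool} {x : Closure L κ} {p : Condition L κ Λ}
    (h : Entails (p.1 b) x) : p ∈ (force Λ b x).val :=
  mem_force.2 fun q hq => ⟨q, le_rfl, h.mono (hq b)⟩

theorem mem_force_of_mem {b : Bool} {x : Closure L κ} {p : Condition L κ Λ}
    (h : x ∈ p.1 b) : p ∈ (force Λ b x).val :=
  mem_force_of_entails (entails_of_mem h)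

theorem le_force_of_forall {b : Bool} {x : Closure L κ}
    {a : RegularLowerSet (Condition L κ Λ)}
    (h : ∀ p : Condition L κ Λ, Entails (p.1 b) x → ∃ q ≤ p, q ∈ a.val) :
    force Λ b x ≤ a := by
  refine le_of_forall_mem_exists fun p hp => ?_
  obtain ⟨q, hq, hqx⟩ := mem_force.1 hp p le_rfl
  obtain ⟨r, hr, hra⟩ := h q hqx
  exact ⟨r, hr.trans hq, hra⟩

theorem exists_le_entails {ι : Type*} [Finite ι] {b : Bool} {x : ι → Closure L κ}
    {p : Condition L κ Λ} (hp : p ∈ (⨅ i, force Λ b (x i)).val) :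
    ∃ q ≤ p, ∀ i, Entails (q.1 b) (x i) := by
  classical
  cases nonempty_fintype ι
  suffices h : ∀ s : Finset ι, ∃ q ≤ p, ∀ i ∈ s, Entails (q.1 b) (x i) by
    simpa using h Finset.univ
  intro s
  induction s using Finset.induction_on with
  | empty => exact ⟨p, le_rfl, by simp⟩
  | insert j s hj ih =>
    obtain ⟨q, hq, hqs⟩ := ih
    obtain ⟨r, hr, hrj⟩ := mem_force.1 (mem_of_le_of_mem (iInf_le _ j) hp) q hq
    refine ⟨r, hr.trans hq, fun i hi => ?_⟩
    rcases Finset.mem_insert.1 hi with rfl | hi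
    · exact hrj
    · exact (hqs i hi).mono (hr b)

/-- Finitely many successive extensions reach one condition entailing all premises, so every sound
inference with finitely many premises passes to `force`. -/
theorem iInf_force_le {ι : Type*} [Finite ι] {b : Bool} {x : ι → Closure L κ} {y : Closure L κ}
    (h : ∀ (B : Type u) [CompleteBooleanAlgebra B] (M : BooleanModel L B) (s : Var κ → M.Carrier),
      ⨅ i, M.closureVal s (x i) ≤ M.closureVal s y) :
    ⨅ i, force Λ b (x i) ≤ force Λ b y := by
  refine le_of_forall_mem_exists fun p hp => ?_
  obtain ⟨q, hq, hqx⟩ := exists_le_entails hp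
  exact ⟨q, hq, mem_force_of_entails fun B _ M hM s =>
    (le_iInf fun i => hqx i B M hM s).trans (h B M s)⟩

theorem force_inf_force_le {b : Bool} {x₁ x₂ y : Closure L κ}
    (h : ∀ (B : Type u) [CompleteBooleanAlgebra B] (M : BooleanModel L B) (s : Var κ → M.Carrier),
      M.closureVal s x₁ ⊓ M.closureVal s x₂ ≤ M.closureVal s y) :
    force Λ b x₁ ⊓ force Λ b x₂ ≤ force Λ b y := by
  have := iInf_force_le (Λ := Λ) (b := b) (x := fun i : Bool => if i then x₁ else x₂) (y := y)
    fun B _ M s => by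
      rw [iInf_bool_eq]
      exact h B M s
  rw [iInf_bool_eq] at this
  exact this

theorem force_mono {b : Bool} {x y : Closure L κ}
    (h : ∀ (B : Type u) [CompleteBooleanAlgebra B] (M : BooleanModel L B) (s : Var κ → M.Carrier),
      M.closureVal s x ≤ M.closureVal s y) :
    force Λ b x ≤ force Λ b y :=
  (le_inf le_rfl le_rfl).trans (force_inf_force_le fun B _ M s => inf_le_left.trans (h B M s))

theorem disjoint_force_neg (hκ : ℵ₀ ≤ κ) {b : Bool} {x : Closure L κ} :
    Disjoint (force Λ b x) (force Λ b x.neg) := by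
  rw [disjoint_iff_inf_le]
  intro p hp
  obtain ⟨q, hq, hqx⟩ := mem_force.1 hp.1 p le_rfl
  obtain ⟨r, hr, hrx⟩ := mem_force.1 hp.2 q hq
  exact (r.not_entails_neg hκ b x (hqx.mono (hr b)) hrx).elim

theorem force_neg (hκ : ℵ₀ ≤ κ) {b : Bool} {x : Closure L κ} (hx : x.support.Finite) :
    force Λ b x.neg = (force Λ b x)ᶜ := by
  apply le_antisymm
  · exact (disjoint_force_neg hκ).symm.le_compl_right
  · refine le_of_forall_mem_exists fun p hp => ?_
    obtain ⟨q, hq, h | h⟩ := p.exists_le_decide hκ b x hx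
    · exact (mem_compl.1 hp q hq (mem_force_of_mem h)).elim
    · exact ⟨q, hq, mem_force_of_mem h⟩

/-- If side `b` entails `θ`, an extension deciding `θ` on the other side cannot contain `¬θ` there,
for `θ` itself would then separate. -/
theorem force_eq_force (hκ : ℵ₀ ≤ κ) {θ : PreFormula L κ} (hθ : θ.IsFormula)
    (hΛ : θ.vocabulary ≤ Λ true ⊓ Λ false) (b b' : Bool) :
    force Λ b (θ, id) = force Λ b' (θ, id) := by
  have key : ∀ b, force Λ b (θ, id) ≤ force Λ (!b) (θ, id) := by
    intro b
    refine le_force_of_forall (x := (θ, id)) fun p hp => ?_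
    obtain ⟨q, hq, h | h⟩ := p.exists_le_decide hκ (!b) (θ, id) (hθ.finite_freeVars.image _)
    · exact ⟨q, hq, mem_force_of_mem h⟩
    · exact (q.not_separates b θ ⟨hθ, hΛ, hp.mono (hq b), entails_of_mem h⟩).elim
  rcases b with _ | _ <;> rcases b' with _ | _
  · rfl
  · exact le_antisymm (key false) (key true)
  · exact le_antisymm (key true) (key false)
  · rfl

variable (Λ)

/-- Equality of variables in the generic model. -/
noncomputable def genericEquiv (κ : Cardinal.{u}) (Λ : Bool → Set L.Rel × Set L.Const) :
    BooleanEquiv (Var κ) (RegularLowerSet (Condition L κ Λ)) where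
  eqv c d := force Λ true (.eq (.var c) (.var d), id)
  refl _ := top_le_iff.1 fun _ _ => mem_force_of_entails fun _ _ M _ _ =>
    le_top.trans_eq (M.eqv_refl _).symm
  symm _ _ := le_antisymm (force_mono fun _ _ M _ => (M.eqv_symm _ _).le)
    (force_mono fun _ _ M _ => (M.eqv_symm _ _).le)
  trans _ _ _ := force_inf_force_le fun _ _ M _ => M.eqv_trans _ _ _

/-- An equation between variables has no non-logical symbols, so it belongs to both vocabularies. -/
theorem genericEquiv_eqv (hκ : ℵ₀ ≤ κ) (b : Bool) (c d : Var κ) :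
    (genericEquiv κ Λ).eqv c d = force Λ b (.eq (.var c) (.var d), id) := by
  refine force_eq_force hκ (by trivial) ⟨?_, ?_⟩ _ _ <;>
    simp [PreFormula.vocabulary, PreFormula.relSymbols, PreFormula.constSymbols, Term.consts]

open Classical in
/-- The relations between variables in the generic model. -/
noncomputable def genericRel (R : L.Rel) (c : Fin (L.arity R) → Var κ) :
    RegularLowerSet (Condition L κ Λ) :=
  force Λ (decide (R ∈ (Λ true).1)) (.rel R fun i => .var (c i), id)

/-- Either `R` is common and the sides agree, or it belongs to one vocabulary only and the test in
`genericRel` picks that side. -/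
theorem genericRel_eq (hκ : ℵ₀ ≤ κ) {b : Bool} {R : L.Rel} (hR : R ∈ (Λ b).1)
    (c : Fin (L.arity R) → Var κ) :
    genericRel Λ R c = force Λ b (.rel R fun i => .var (c i), id) := by
  classical
  by_cases h : R ∈ (Λ true).1 ∧ R ∈ (Λ false).1
  · refine force_eq_force hκ (by trivial) ⟨?_, ?_⟩ _ _
    · simpa [PreFormula.vocabulary, PreFormula.relSymbols] using h
    · simp [PreFormula.vocabulary, PreFormula.constSymbols, Term.consts]
  · have : decide (R ∈ (Λ true).1) = b := by cases b <;> simp_all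
    rw [genericRel, this]

/-- The interpretation of a constant on the side `b`. -/
noncomputable def constPoint (hκ : ℵ₀ ≤ κ) (b : Bool) (k : L.Const) :
    BooleanPoint (genericEquiv κ Λ) where
  toFun c := force Λ b (.eq (.const k) (.var c), id)
  strict c d := by
    rw [genericEquiv_eqv Λ hκ b]
    refine force_inf_force_le fun B _ M s => ?_
    simp only [closureVal, val]
    rw [M.eqv_symm (M.termVal _ (.const k))]
    exact M.eqv_trans _ _ _
  extensional c d := by
    rw [genericEquiv_eqv Λ hκ b]
    refine force_inf_force_le fun B _ M s => ?_
    rw [inf_comm]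
    exact M.eqv_trans _ _ _
  total := by
    refine top_le_iff.1 (le_of_forall_mem_exists fun p _ => ?_)
    have := infinite_var hκ
    obtain ⟨y⟩ : Nonempty (Var κ) := inferInstance
    -- The valid statement `∃ y, k = y` lets every condition be extended so as to name `k` by a
    -- variable.
    obtain ⟨a, q, hq, hqa⟩ := p.exists_le_of_iSup_update hκ b (.eq (.const k) (.var y))
      (PreFormula.IsFormula.finite_freeVars (by trivial)) id {y} fun B _ M hM s => by
        refine le_top.trans ?_
        refine le_iSup_of_le (fun _ => M.const k) ?_
        simp [val, termVal, update, M.eqv_refl]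
    refine ⟨q, hq, mem_of_le_of_mem (le_iSup (fun c => force Λ b (.eq (.const k) (.var c), id))
      (a ⟨y, by simp⟩)) (mem_force_of_entails fun B _ M hM s => ?_)⟩
    refine (entails_of_mem hqa B M hM s).trans_eq ?_
    simp [closureVal, val, termVal, update]

open Classical in
/-- The generic model. -/
noncomputable def genericModel (hκ : ℵ₀ ≤ κ) (Λ : Bool → Set L.Rel × Set L.Const) :
    BooleanModel L (RegularLowerSet (Condition L κ Λ)) :=
  have : Nonempty (Var κ) := (infinite_var hκ).nonempty
  completion (genericEquiv κ Λ) (genericRel Λ)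
    fun k => constPoint Λ hκ (decide (k ∈ (Λ true).2)) k

/-- The element of the generic model denoted by a variable. -/
noncomputable def genericElement (hκ : ℵ₀ ≤ κ) (c : Var κ) : (genericModel hκ Λ).Carrier :=
  BooleanPoint.of (genericEquiv κ Λ) c

theorem genericModel_mixing (hκ : ℵ₀ ≤ κ) : (genericModel hκ Λ).Mixing :=
  have : Nonempty (Var κ) := (infinite_var hκ).nonempty
  completion_mixing _ _ _

variable {Λ}

/-- Renaming of the variables of a term. -/
def Term.rename (e : Var κ → Var κ) : Term L κ → Term L κ
  | .var x => .var (e x)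
  | .const c => .const c

theorem termVal_rename {B : Type u} [CompleteBooleanAlgebra B] (M : BooleanModel L B)
    (s : Var κ → M.Carrier) (e : Var κ → Var κ) (t : Term L κ) :
    M.termVal s (t.rename e) = M.termVal (s ∘ e) t := by
  cases t <;> rfl

/-- The value of a term in the generic model. -/
noncomputable def termPoint (Λ : Bool → Set L.Rel × Set L.Const) (hκ : ℵ₀ ≤ κ) (t : Term L κ)
    (e : Var κ → Var κ) : BooleanPoint (genericEquiv κ Λ) :=
  (genericModel hκ Λ).termVal (genericElement Λ hκ ∘ e) t

theorem termPoint_toFun (hκ : ℵ₀ ≤ κ) {b : Bool} {t : Term L κ} (ht : t.consts ⊆ (Λ b).2)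
    (e : Var κ → Var κ) (c : Var κ) :
    (termPoint Λ hκ t e).toFun c = force Λ b (.eq (t.rename e) (.var c), id) := by
  classical
  cases t with
  | var x => exact genericEquiv_eqv Λ hκ b (e x) c
  | const k =>
    change force Λ (decide (k ∈ (Λ true).2)) (.eq (.const k) (.var c), id) = _
    have hk : k ∈ (Λ b).2 := ht rfl
    by_cases h : k ∈ (Λ true).2 ∧ k ∈ (Λ false).2
    · refine force_eq_force hκ (by trivial) ⟨?_, ?_⟩ _ _
      · simp [PreFormula.vocabulary, PreFormula.relSymbols]
      · simpa [PreFormula.vocabulary, PreFormula.constSymbols, Term.consts] using h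
    · have : decide (k ∈ (Λ true).2) = b := by cases b <;> simp_all
      rw [this]
      rfl

theorem genericModel_val_eq (hκ : ℵ₀ ≤ κ) {b : Bool} {t₁ t₂ : Term L κ}
    (h₁ : t₁.consts ⊆ (Λ b).2) (h₂ : t₂.consts ⊆ (Λ b).2) (e : Var κ → Var κ) :
    (genericModel hκ Λ).val (.eq t₁ t₂) (genericElement Λ hκ ∘ e) =
      force Λ b (.eq t₁ t₂, e) := by
  change ⨆ c, (termPoint Λ hκ t₁ e).toFun c ⊓ (termPoint Λ hκ t₂ e).toFun c = _
  apply le_antisymm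
  · refine iSup_le fun c => ?_
    rw [termPoint_toFun hκ h₁, termPoint_toFun hκ h₂]
    refine force_inf_force_le fun B _ M s => ?_
    simp only [closureVal, val, termVal_rename, Function.comp_id]
    rw [M.eqv_symm (M.termVal (s ∘ e) t₂)]
    exact M.eqv_trans _ _ _
  -- Totality of the point denoted by `t₁` provides variables `c` equal to `t₁`, with values
  -- covering `⊤`.
  · rw [← top_inf_eq (force Λ b _), ← (termPoint Λ hκ t₁ e).total, iSup_inf_eq]
    refine iSup_mono fun c => le_inf inf_le_left ?_
    rw [termPoint_toFun hκ h₁, termPoint_toFun hκ h₂]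
    refine force_inf_force_le fun B _ M s => ?_
    simp only [closureVal, val, termVal_rename, Function.comp_id]
    rw [inf_comm, M.eqv_symm (M.termVal (s ∘ e) t₁) (M.termVal (s ∘ e) t₂)]
    exact M.eqv_trans _ _ _

theorem genericModel_val_rel (hκ : ℵ₀ ≤ κ) {b : Bool} {R : L.Rel} (hR : R ∈ (Λ b).1)
    {ts : Fin (L.arity R) → Term L κ} (ht : ∀ i, (ts i).consts ⊆ (Λ b).2) (e : Var κ → Var κ) :
    (genericModel hκ Λ).val (.rel R ts) (genericElement Λ hκ ∘ e) =
      force Λ b (.rel R ts, e) := by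
  change ⨆ c : Fin (L.arity R) → Var κ, (⨅ i, (termPoint Λ hκ (ts i) e).toFun (c i)) ⊓
    genericRel Λ R c = _
  simp_rw [genericRel_eq Λ hκ hR, termPoint_toFun hκ (ht _)]
  -- The equations and the premise `x` form one finite family, indexed by `Option`.
  have key : ∀ (c : Fin (L.arity R) → Var κ) (x y : Closure L κ),
      (∀ (B : Type u) [CompleteBooleanAlgebra B] (M : BooleanModel L B) (s : Var κ → M.Carrier),
        (⨅ i, M.eqv (M.termVal (s ∘ e) (ts i)) (s (c i))) ⊓ M.closureVal s x ≤
          M.closureVal s y) →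
      (⨅ i, force Λ b (.eq ((ts i).rename e) (.var (c i)), id)) ⊓ force Λ b x ≤ force Λ b y := by
    intro c x y h
    have := iInf_force_le (Λ := Λ) (b := b) (y := y) (x := fun i : Option (Fin (L.arity R)) =>
      i.elim x fun i => (.eq ((ts i).rename e) (.var (c i)), id)) fun B _ M s => by
        rw [iInf_option, inf_comm]
        have := h B M s
        simp only [Option.elim, closureVal, val, termVal_rename, Function.comp_id] at this ⊢
        exact this
    rw [iInf_option, inf_comm] at this
    exact this
  apply le_antisymm
  · refine iSup_le fun c => key c _ _ fun B _ M s => ?_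
    simp_rw [M.eqv_symm (M.termVal _ _)]
    exact M.rel_congr R _ _
  · rw [← top_inf_eq (force Λ b _), ← iSup_iInf_eq_top_of_finite
      (fun i => (termPoint Λ hκ (ts i) e).toFun) fun i => (termPoint Λ hκ (ts i) e).total,
      iSup_inf_eq]
    simp_rw [termPoint_toFun hκ (ht _)]
    exact iSup_mono fun c => le_inf inf_le_left (key c _ _ fun B _ M s => M.rel_congr R _ _)

/-- The truth lemma. Disjunctions and existential quantifiers use the extension properties directly;
conjunctions and universal quantifiers use them for the negation, after deciding the formula. -/
theorem genericModel_val (hκ : ℵ₀ ≤ κ) (b : Bool) {χ : PreFormula L κ} (hχ : χ.IsFormula)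
    (hΛ : χ.vocabulary ≤ Λ b) (e : Var κ → Var κ) :
    (genericModel hκ Λ).val χ (genericElement Λ hκ ∘ e) = force Λ b (χ, e) := by
  have : Nonempty (Var κ) := (infinite_var hκ).nonempty
  induction χ generalizing e with
  | eq t₁ t₂ =>
    exact genericModel_val_eq hκ (Set.subset_union_left.trans hΛ.2)
      (Set.subset_union_right.trans hΛ.2) e
  | rel R ts =>
    exact genericModel_val_rel hκ (hΛ.1 rfl)
      (fun i => (Set.subset_iUnion (fun i => (ts i).consts) i).trans hΛ.2) e
  | neg χ ih =>
    refine Eq.trans ?_ (force_neg hκ (x := (χ, e)) (hχ.finite_freeVars.image _)).symm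
    rw [← ih hχ hΛ e]
    rfl
  | conj I hI Φ ih =>
    have ih' := fun i => ih i (hχ.1 i)
      ⟨(Set.subset_iUnion (fun i => (Φ i).relSymbols) i).trans hΛ.1,
        (Set.subset_iUnion (fun i => (Φ i).constSymbols) i).trans hΛ.2⟩ e
    simp only [val, ih']
    apply le_antisymm
    · refine le_of_forall_mem_exists fun p hp => ?_
      obtain ⟨q, hq, h | h⟩ := p.exists_le_decide hκ b (.conj I hI Φ, e)
        (hχ.finite_freeVars.image _)
      · exact ⟨q, hq, mem_force_of_mem h⟩
      -- A condition containing the negated conjunction extends to one containing some `¬Φ i`,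
      -- although `p` forces every `Φ i`.
      · obtain ⟨i, r, hr, hri⟩ := q.exists_le_of_iSup b hI
          (fun i => Closure.neg (Φ i, e)) (by
            refine (hχ.2.image e).subset (Set.iUnion_subset fun i => ?_)
            exact Set.image_mono (Set.subset_iUnion (fun i => (Φ i).freeVars) i))
          (fun B _ M hM s => by
            refine (entails_of_mem h B M hM s).trans_eq ?_
            simp only [closureVal, Closure.neg, val, compl_iInf])
        exact (notMem_bot r ((disjoint_force_neg hκ).le_bot
          ⟨mem_of_le_of_mem (iInf_le _ i) (mem_of_le (hr.trans hq) hp),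
            mem_force_of_mem hri⟩)).elim
    · exact le_iInf fun i => force_mono fun B _ M s => iInf_le _ i
  | disj I hI Φ ih =>
    have ih' := fun i => ih i (hχ.1 i)
      ⟨(Set.subset_iUnion (fun i => (Φ i).relSymbols) i).trans hΛ.1,
        (Set.subset_iUnion (fun i => (Φ i).constSymbols) i).trans hΛ.2⟩ e
    simp only [val, ih']
    apply le_antisymm
    · exact iSup_le fun i => force_mono fun B _ M s =>
        le_iSup (fun i => M.val (Φ i) (s ∘ e)) i
    · refine le_force_of_forall (x := (.disj I hI Φ, e)) fun p hp => ?_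
      obtain ⟨i, r, hr, hri⟩ := p.exists_le_of_iSup b hI (fun i => (Φ i, e)) (by
          refine (hχ.2.image e).subset (Set.iUnion_subset fun i => ?_)
          exact Set.image_mono (Set.subset_iUnion (fun i => (Φ i).freeVars) i)) hp
      exact ⟨r, hr, mem_of_le_of_mem (le_iSup (fun i => force Λ b (Φ i, e)) i)
        (mem_force_of_mem hri)⟩
  | all V χ ih =>
    refine (completion_val_all χ V e).trans ?_
    refine (iInf_congr fun a => ih hχ hΛ (update e V a)).trans ?_
    apply le_antisymm
    · refine le_of_forall_mem_exists fun p hp => ?_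
      obtain ⟨q, hq, h | h⟩ := p.exists_le_decide hκ b (.all V χ, e)
        ((PreFormula.IsFormula.finite_freeVars (φ := .all V χ) hχ).image _)
      · exact ⟨q, hq, mem_force_of_mem h⟩
      · obtain ⟨a, r, hr, hra⟩ := q.exists_le_of_iSup_update hκ b (.neg χ)
          (PreFormula.IsFormula.finite_freeVars (φ := .neg χ) hχ) e V
          (fun B _ M hM s => by
            refine (entails_of_mem h B M hM s).trans_eq ?_
            simp only [closureVal, Closure.neg, val, compl_iInf])
        exact (notMem_bot r ((disjoint_force_neg hκ (x := (χ, update e V a))).le_bot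
          ⟨mem_of_le_of_mem (iInf_le _ a) (mem_of_le (hr.trans hq) hp),
            mem_force_of_mem hra⟩)).elim
    · refine le_iInf fun a => force_mono fun B _ M s => ?_
      simp only [closureVal, update_comp]
      exact iInf_le (fun m => M.val χ (update (s ∘ e) V m)) (s ∘ a)
  | ex V χ ih =>
    refine (completion_val_ex χ V e).trans ?_
    refine (iSup_congr fun a => ih hχ hΛ (update e V a)).trans ?_
    apply le_antisymm
    · refine iSup_le fun a => force_mono fun B _ M s => ?_
      simp only [closureVal, update_comp]
      exact le_iSup (fun m => M.val χ (update (s ∘ e) V m)) (s ∘ a)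
    · refine le_force_of_forall (x := (.ex V χ, e)) fun p hp => ?_
      obtain ⟨a, r, hr, hra⟩ := p.exists_le_of_iSup_update hκ b χ
        (PreFormula.IsFormula.finite_freeVars (φ := χ) hχ) e V hp
      exact ⟨r, hr, mem_of_le_of_mem (le_iSup (fun a => force Λ b (χ, update e V a)) a)
        (mem_force_of_mem hra)⟩

end Forcing

/-! ### From the generic model to interpolation -/

theorem shValid_imp_iff (hκ : ℵ₀ ≤ κ) (φ ψ : PreFormula L κ) :
    ShValid (.imp hκ φ ψ) ↔ ∀ (B : Type u) [CompleteBooleanAlgebra B] (M : BooleanModel L B),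
      M.Mixing → ∀ s : Var κ → M.Carrier, M.val φ s ≤ M.val ψ s := by
  have key : ∀ {B : Type u} [CompleteBooleanAlgebra B] (a b : B), aᶜ ⊔ b = ⊤ ↔ a ≤ b := by
    intro B _ a b
    rw [sup_comm, ← himp_eq, himp_eq_top_iff]
  simp [ShValid, ShEntails, val_imp, key]

theorem exists_separates (hκ : ℵ₀ ≤ κ) {φ ψ : PreFormula L κ} (hφ : φ.IsSentence)
    (hψ : ψ.IsSentence) (h : ShValid (.imp hκ φ ψ)) :
    ∃ θ, Separates (φ.vocabulary ⊓ ψ.vocabulary) {((φ, id) : Closure L κ)} {(.neg ψ, id)} θ := by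
  by_contra hc
  let Λ : Bool → Set L.Rel × Set L.Const := fun b => if b then φ.vocabulary else ψ.vocabulary
  -- The assumption `hc` is exactly what makes this pair a condition.
  let p : Condition L κ Λ := ⟨fun b => if b then {(φ, id)} else {(PreFormula.neg ψ, id)}, by
    rintro (_ | _) <;> simp [support, Closure.support, hφ.2, hψ.2, PreFormula.freeVars], hc⟩
  have hpφ : p ∈ ((genericModel hκ Λ).val φ (genericElement Λ hκ ∘ id)).val := by
    rw [genericModel_val hκ true hφ.1 le_rfl]
    exact mem_force_of_mem rfl
  have hpψ : p ∈ ((genericModel hκ Λ).val (.neg ψ) (genericElement Λ hκ ∘ id)).val := by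
    rw [genericModel_val hκ false (χ := .neg ψ) hψ.1 le_rfl]
    exact mem_force_of_mem rfl
  have hle := (shValid_imp_iff hκ φ ψ).1 h _ (genericModel hκ Λ) (genericModel_mixing Λ hκ)
    (genericElement Λ hκ ∘ id)
  exact mem_compl.1 hpψ p le_rfl (mem_of_le_of_mem hle hpφ)

end RelSignature

theorem mainTheorem3 (L : RelSignature.{u}) (κ : Cardinal.{u}) (hκ : ℵ₀ ≤ κ)
    (φ ψ : RelSignature.PreFormula L κ) (hφ : φ.IsSentence) (hψ : ψ.IsSentence)
    (h : RelSignature.ShValid (RelSignature.PreFormula.imp hκ φ ψ)) :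
    ∃ θ : RelSignature.PreFormula L κ, θ.IsSentence ∧
      RelSignature.ShValid (RelSignature.PreFormula.imp hκ φ θ) ∧
      RelSignature.ShValid (RelSignature.PreFormula.imp hκ θ ψ) ∧
      θ.relSymbols ⊆ φ.relSymbols ∩ ψ.relSymbols ∧
      θ.constSymbols ⊆ φ.constSymbols ∩ ψ.constSymbols := by
  obtain ⟨θ₀, hθ₀⟩ := RelSignature.exists_separates hκ hφ hψ h
  -- Since `φ` is a sentence, all free variables of the separator can be quantified away.
  obtain ⟨θ, hθ, hF⟩ := hθ₀.exists_freeVars_subset (F := ∅)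
    (by simp [RelSignature.support, RelSignature.Closure.support, hφ.2])
  refine ⟨θ, ⟨hθ.isFormula, Set.subset_empty_iff.1 hF⟩, ?_, ?_, hθ.vocabulary_le.1,
    hθ.vocabulary_le.2⟩
  · rw [RelSignature.shValid_imp_iff]
    intro B _ M hM s
    simpa [RelSignature.BooleanModel.setVal, RelSignature.BooleanModel.closureVal]
      using hθ.left B M hM s
  · rw [RelSignature.shValid_imp_iff]
    intro B _ M hM s
    simpa [RelSignature.BooleanModel.setVal, RelSignature.BooleanModel.closureVal,
      RelSignature.BooleanModel.val] using hθ.right B M hM s
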